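/- Let $M>0$ and $t\ge b\ge 0$, and for $|z|\le e^{-b}-e^{-t}$ put $$K(z)=(4e^{-b-t})^{-M}\bigl((e^{-t}+e^{-b})^2-z^2\bigr)^{-\frac12+M}F\Bigl(\tfrac12-M,\tfrac12-M;1;\frac{(e^{-b}-e^{-t})^2-z^2}{(e^{-b}+e^{-t})^2-z^2}\Bigr),$$ where $F$ is Gauss's hypergeometric function. For $k\ge 1$ let $\omega_k$ denote the area of the unit sphere $S^{k}\subset\mathbb R^{k+1}$. Then the following representations hold (all integrals converge absolutely, and all derivatives exist for $r>0$). (i) $$\frac1M\sinh(M(t-b))=\int_{-(e^{-b}-e^{-t})}^{e^{-b}-e^{-t}}K(z)\,dz .$$ (ii) If $n\ge 3$ is odd, then with $c_0^{(n)}=1\cdot3\cdots(n-2)$, $$\frac1M\sinh(M(t-b))=2\int_0^{e^{-b}-e^{-t}}\left(\frac{\partial}{\partial r}\Bigl(\frac1r\frac{\partial}{\partial r}\Bigr)^{\frac{n-3}2}\frac{r^{n-2}}{\omega_{n-1}c_0^{(n)}}\int_{S^{n-1}}dS_y\right)_{r=r_1}K(r_1)\,dr_1 .$$ (iii) If $n\ge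 2$ is even, then with $c_0^{(n)}=1\cdot3\cdots(n-1)$, $$\frac1M\sinh(M(t-b))=2\int_0^{e^{-b}-e^{-t}}\left(\frac{\partial}{\partial r}\Bigl(\frac1r\frac{\partial}{\partial r}\Bigr)^{\frac{n-2}2}\frac{2r^{n-1}}{\omega_{n}c_0^{(n)}}\int_{|y|\le 1}\frac{dV_y}{\sqrt{1-|y|^2}}\right)_{r=r_1}K(r_1)\,dr_1 .$$ -/

import Mathlib

open MeasureTheory Set Metric
open scoped Nat

noncomputable section

/-- The kernel
`(4e^{-b-t})^{-M} ((e^{-t}+e^{-b})² - z²)^{-1/2+M} F(1/2-M, 1/2-M; 1; ζ)` with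
`ζ = ((e^{-b}-e^{-t})² - z²) / ((e^{-b}+e^{-t})² - z²)`, where `F` is Gauss's hypergeometric
function. For `|z| ≤ e^{-b} - e^{-t}` one has `0 ≤ ζ < 1`, so `F` is given by its
convergent power series, and the two bases of the real powers are positive. -/
def deSitterKernel (M t b z : ℝ) : ℝ :=
  (4 * Real.exp (-b - t)) ^ (-M)
    * ((Real.exp (-t) + Real.exp (-b)) ^ 2 - z ^ 2) ^ (-(1 / 2 : ℝ) + M)
    * ordinaryHypergeometric (1 / 2 - M) (1 / 2 - M) (1 : ℝ)
        (((Real.exp (-b) - Real.exp (-t)) ^ 2 - z ^ 2)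
          / ((Real.exp (-b) + Real.exp (-t)) ^ 2 - z ^ 2))

/-- The surface measure on the unit sphere `S^{n-1}` of `ℝⁿ`. -/
def sphereMeasure (n : ℕ) : Measure (sphere (0 : EuclideanSpace ℝ (Fin n)) 1) :=
  (volume : Measure (EuclideanSpace ℝ (Fin n))).toSphere

/-- `sphereArea k` is the surface area `ω_k` of the unit sphere `S^k ⊂ ℝ^{k+1}`. -/
def sphereArea (k : ℕ) : ℝ :=
  (sphereMeasure (k + 1)).real univ

/-- The operator `(1/r) ∂/∂r` on functions of the radial variable. -/
def radialDeriv (g : ℝ → ℝ) : ℝ → ℝ :=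
  fun r => 1 / r * deriv g r

/-- `r^{n-2} / (ω_{n-1} c₀) ∫_{S^{n-1}} dS_y` with `c₀ = 1·3·…·(n-2)`, for odd `n ≥ 3`. -/
def sphericalMean (n : ℕ) (r : ℝ) : ℝ :=
  r ^ (n - 2) / (sphereArea (n - 1) * ((n - 2)‼ : ℕ))
    * ∫ _y : sphere (0 : EuclideanSpace ℝ (Fin n)) 1, (1 : ℝ) ∂(sphereMeasure n)

/-- `2 r^{n-1} / (ω_n c₀) ∫_{|y| ≤ 1} (1 - |y|²)^{-1/2} dV_y` with `c₀ = 1·3·…·(n-1)`,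
for even `n ≥ 2`; here `ω_n` is the area of `S^n ⊂ ℝ^{n+1}`. -/
def ballMean (n : ℕ) (r : ℝ) : ℝ :=
  2 * r ^ (n - 1) / (sphereArea n * ((n - 1)‼ : ℕ))
    * ∫ y in closedBall (0 : EuclideanSpace ℝ (Fin n)) 1, 1 / √(1 - ‖y‖ ^ 2)

end

/-!
Write `β = M - 1/2`, `R = e^{-b} - e^{-t}`, `S = e^{-b} + e^{-t}` and `x = R / S`, so that
`S² - R² = 4 e^{-b-t}`. After the substitution `z = R s` the kernel becomes a constant times
`(1 - x² s²) ^ β F(-β, -β; 1; x² (1 - s²) / (1 - x² s²))`. Since `F(-β, -β; 1; ζ) = ∑ₖ C(β,k)² ζᵏ`,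
expanding every factor `(1 - x² s²) ^ (β - k)` in its binomial series gives an absolutely convergent
double series; collecting the powers of `x²`, and using `C(β,k) C(β-k,j) = C(β,k+j) C(k+j,k)`, the
coefficient of `x^{2N}` is the polynomial
`C(β,N) ∑_{k+j=N} C(β,k) C(N,k) (1 - s²)ᵏ (-s²)ʲ` (`hasSum_kernelCoeff_mul_pow`).

The integral over `s ∈ [0, 1]` is taken term by term. The beta integrals
`C(N,k) (-1)ʲ ∫₀¹ (1 - s²)ᵏ s^{2j} ds` equal `C(-1/2,j) ∫₀¹ (1 - s²)ᴺ ds`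
(`choose_mul_integral_one_sub_sq_pow`), so the sum over `k + j = N` is a Vandermonde convolution and
collapses to `C(β - 1/2, N)`. What is left is, up to the factor `2M`, the odd part of the binomial
series of `(1 + x) ^ (2M)` (`choose_mul_choose_sub_half`), whence
`2M x ∫₀¹ … ds = ((1 + x) ^ (2M) - (1 - x) ^ (2M)) / 2`
(`integral_rpow_mul_ordinaryHypergeometric`). As `S (1 + x) = 2 e^{-b}` and `S (1 - x) = 2 e^{-t}`,
this is the hyperbolic sine (`integral_deSitterKernel_zero`), and the evenness of the kernel gives
the one-dimensional formula.

In higher dimensions both radial weights reduce to that case: with `n = 2m + 3`, respectively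
`n = 2m + 2`, the function under the differential operator is `r^{2m+1} / (2m+1)‼`
(`sphericalMean_eq`, `ballMean_eq`). For the ball this says that `∫ (1 - |y|²)^{-1/2}` is half the
area of `S^n`, the ball being the projection of a hemisphere; it is proved in polar coordinates.
Each `(1/r) d/dr` lowers `m` by one, and the last derivative turns `r` into the constant weight `1`.
-/

/-! ### Binomial series and the hypergeometric function -/

theorem hasSum_choose_mul_pow (β : ℝ) {x : ℝ} (hx : |x| < 1) :
    HasSum (fun n => Ring.choose β n * x ^ n) ((1 + x) ^ β) := by
  have h := (Real.one_add_rpow_hasFPowerSeriesOnBall_zero (a := β)).hasSum (y := x)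
    (by simpa [enorm_eq_nnnorm, ← NNReal.coe_lt_coe] using hx)
  simpa [binomialSeries, FormalMultilinearSeries.coeff_ofScalars, mul_comm] using h

/-- Generalized binomial coefficients grow slower than any geometric sequence of ratio
`1 / r > 1`. -/
theorem exists_abs_choose_mul_pow_le (β : ℝ) {r : ℝ} (hr0 : 0 ≤ r) (hr : r < 1) :
    ∃ B : ℝ, 0 ≤ B ∧ ∀ n, |Ring.choose β n| * r ^ n ≤ B := by
  have hs := (hasSum_choose_mul_pow β (x := r) (by rwa [abs_of_nonneg hr0])).summable
  obtain ⟨B, hB⟩ := hs.tendsto_atTop_zero.norm.bddAbove_range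
  have h : ∀ n, |Ring.choose β n| * r ^ n ≤ B := fun n => by
    have := hB (mem_range_self n)
    simpa [abs_mul, abs_of_nonneg hr0] using this
  exact ⟨B, (by positivity : 0 ≤ |Ring.choose β 0| * r ^ 0).trans (h 0), h⟩

theorem choose_mul_choose_sub (β : ℝ) (k j : ℕ) :
    Ring.choose β k * Ring.choose (β - k) j = Ring.choose β (k + j) * (k + j).choose k := by
  have := Ring.choose_smul_choose β (Nat.le_add_right k j)
  simp only [nsmul_eq_mul, Nat.add_sub_cancel_left] at this
  linarith

theorem ascPochhammer_eval_neg_eq_choose (β : ℝ) (k : ℕ) :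
    (ascPochhammer ℝ k).eval (-β) = (-1) ^ k * (k ! * Ring.choose β k) := by
  have h := Ring.descPochhammer_eq_factorial_smul_choose β k
  rw [ascPochhammer_eval_neg_eq_descPochhammer, ← nsmul_eq_mul, ← h]
  simp [Polynomial.descPochhammer_smeval_eq_ascPochhammer,
    Polynomial.ascPochhammer_smeval_eq_eval, descPochhammer_eval_eq_ascPochhammer]

theorem ordinaryHypergeometric_neg_neg_one (β x : ℝ) :
    ordinaryHypergeometric (-β) (-β) (1 : ℝ) x = ∑' k : ℕ, Ring.choose β k ^ 2 * x ^ k := by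
  rw [ordinaryHypergeometric_eq_tsum]
  refine tsum_congr fun k => ?_
  have hk : (k ! : ℝ) ≠ 0 := by positivity
  have h1 : ((-1 : ℝ) ^ k) * (-1) ^ k = 1 := by rw [← mul_pow]; simp
  rw [ascPochhammer_eval_neg_eq_choose, ascPochhammer_eval_one, smul_eq_mul]
  field_simp
  linear_combination Ring.choose β k ^ 2 * x ^ k * h1

theorem continuousOn_ordinaryHypergeometric_one (a b : ℝ) :
    ContinuousOn (ordinaryHypergeometric a b (1 : ℝ) : ℝ → ℝ) (ball 0 1) := by
  have hrad : 1 ≤ (ordinaryHypergeometricSeries ℝ a b (1 : ℝ)).radius := by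
    by_cases h : ∀ k : ℕ, (k : ℝ) ≠ -a ∧ (k : ℝ) ≠ -b ∧ (k : ℝ) ≠ -1
    · exact (ordinaryHypergeometricSeries_radius_eq_one ℝ a b 1 h).ge
    · push Not at h
      obtain ⟨k, hk⟩ := h
      have hk1 : (k : ℝ) ≠ -1 := by
        have : (0 : ℝ) ≤ k := k.cast_nonneg
        linarith
      by_cases ha : (k : ℝ) = -a
      · obtain rfl : a = -k := by linarith
        simp [ordinaryHypergeometric_radius_top_of_neg_nat₁]
      · by_cases hb : (k : ℝ) = -b
        · obtain rfl : b = -k := by linarith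
          simp [ordinaryHypergeometric_radius_top_of_neg_nat₂]
        · exact absurd (hk ha hb) hk1
  refine ((ordinaryHypergeometricSeries ℝ a b (1 : ℝ)).continuousOn).mono ?_
  rw [← Metric.eball_ofReal, ENNReal.ofReal_one]
  exact Metric.eball_subset_eball hrad

/-- The coefficient of `q ^ N` in the expansion of
`(1 - q w) ^ β * F(-β, -β; 1; q (1 - w) / (1 - q w))`, a polynomial in `w`. -/
noncomputable def kernelCoeff (β : ℝ) (N : ℕ) (w : ℝ) : ℝ :=
  Ring.choose β N * ∑ p ∈ Finset.HasAntidiagonal.antidiagonal N,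
    Ring.choose β p.1 * N.choose p.1 * (1 - w) ^ p.1 * (-w) ^ p.2

/-- The sum of the absolute values of the terms of `kernelCoeff β N w`. The factors
`N.choose k * (1 - w) ^ k * w ^ j` add up to one, so only the growth of the generalized binomial
coefficients matters. -/
theorem sum_abs_kernelCoeff_term_le {β r B w : ℝ} (hr : 0 < r) (hr1 : r < 1) (hB0 : 0 ≤ B)
    (hB : ∀ n, |Ring.choose β n| * r ^ n ≤ B) (hw0 : 0 ≤ w) (hw1 : w ≤ 1) (N : ℕ) :
    ∑ p ∈ Finset.HasAntidiagonal.antidiagonal N,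
      |Ring.choose β N * (Ring.choose β p.1 * N.choose p.1 * (1 - w) ^ p.1 * (-w) ^ p.2)|
        ≤ B ^ 2 * (1 / r ^ 2) ^ N := by
  have hB' : ∀ n ≤ N, |Ring.choose β n| ≤ B * (1 / r) ^ N := fun n hn => by
    have h1 : r ^ N ≤ r ^ n := pow_le_pow_of_le_one hr.le hr1.le hn
    rw [one_div, inv_pow, ← div_eq_mul_inv, le_div_iff₀ (by positivity)]
    exact (mul_le_mul_of_nonneg_left h1 (abs_nonneg _)).trans (hB n)
  have key : ∀ p ∈ Finset.HasAntidiagonal.antidiagonal N,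
      |Ring.choose β N * (Ring.choose β p.1 * N.choose p.1 * (1 - w) ^ p.1 * (-w) ^ p.2)|
        ≤ (B * (1 / r) ^ N) * (B * (1 / r) ^ N) * ((1 - w) ^ p.1 * w ^ p.2 * N.choose p.1) := by
    intro p hp
    have hp1 : p.1 ≤ N := Finset.HasAntidiagonal.antidiagonal.fst_le hp
    have : |Ring.choose β N * (Ring.choose β p.1 * N.choose p.1 * (1 - w) ^ p.1 * (-w) ^ p.2)|
        = |Ring.choose β N| * |Ring.choose β p.1| * ((1 - w) ^ p.1 * w ^ p.2 * N.choose p.1) := by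
      simp only [abs_mul, abs_pow, abs_neg, abs_of_nonneg hw0, abs_of_nonneg (sub_nonneg.2 hw1),
        Nat.abs_cast]
      ring
    rw [this]
    have h1w : 0 ≤ 1 - w := sub_nonneg.2 hw1
    gcongr
    · exact hB' N le_rfl
    · exact hB' _ hp1
  refine (Finset.sum_le_sum key).trans ?_
  have hbin := (Commute.all (1 - w) w).add_pow' N
  simp only [sub_add_cancel, one_pow, nsmul_eq_mul] at hbin
  rw [← Finset.mul_sum, show ∑ p ∈ Finset.HasAntidiagonal.antidiagonal N,
    ((1 - w) ^ p.1 * w ^ p.2 * (N.choose p.1 : ℝ)) = 1 by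
      exact (Finset.sum_congr rfl fun p _ => mul_comm _ _).trans hbin.symm, mul_one]
  apply le_of_eq
  rw [one_div, one_div, inv_pow, inv_pow, ← pow_mul, mul_comm 2 N, pow_mul]
  field_simp

theorem abs_kernelCoeff_le {β r B w : ℝ} (hr : 0 < r) (hr1 : r < 1) (hB0 : 0 ≤ B)
    (hB : ∀ n, |Ring.choose β n| * r ^ n ≤ B) (hw0 : 0 ≤ w) (hw1 : w ≤ 1) (N : ℕ) :
    |kernelCoeff β N w| ≤ B ^ 2 * (1 / r ^ 2) ^ N := by
  rw [kernelCoeff, Finset.mul_sum]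
  exact (Finset.abs_sum_le_sum_abs _ _).trans (sum_abs_kernelCoeff_term_le hr hr1 hB0 hB hw0 hw1 N)

/-- The expansion in powers of `q`, obtained by summing one absolutely convergent double series
along rows and along antidiagonals. -/
theorem hasSum_kernelCoeff_mul_pow (β : ℝ) {q w : ℝ} (hq0 : 0 ≤ q) (hq1 : q < 1)
    (hw0 : 0 ≤ w) (hw1 : w ≤ 1) :
    HasSum (fun N => kernelCoeff β N w * q ^ N)
      ((1 - q * w) ^ β *
        ordinaryHypergeometric (-β) (-β) (1 : ℝ) (q * (1 - w) / (1 - q * w))) := by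
  -- With `√q < r < 1` the bound `|C(β,n)| ≤ B / rⁿ`, used twice, costs `r⁻²` per power of `q`,
  -- and `q / r² < 1`.
  obtain ⟨r, hrq, hr1⟩ := exists_between
    (show √q < 1 by rw [Real.sqrt_lt' one_pos]; simpa using hq1)
  have hr : 0 < r := (Real.sqrt_nonneg q).trans_lt hrq
  have hqr : q < r ^ 2 := (Real.sqrt_lt' hr).1 hrq
  obtain ⟨B, hB0, hB⟩ := exists_abs_choose_mul_pow_le β hr.le hr1
  have hqw : q * w < 1 := (mul_le_of_le_one_right hq0 hw1).trans_lt hq1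
  have hqw0 : 0 < 1 - q * w := sub_pos.2 hqw
  let f : ℕ × ℕ → ℝ := fun p => Ring.choose β (p.1 + p.2) *
    (Ring.choose β p.1 * (p.1 + p.2).choose p.1 * (1 - w) ^ p.1 * (-w) ^ p.2) * q ^ (p.1 + p.2)
  have hanti : ∀ N, ∀ p ∈ Finset.HasAntidiagonal.antidiagonal N, f p = Ring.choose β N *
    (Ring.choose β p.1 * N.choose p.1 * (1 - w) ^ p.1 * (-w) ^ p.2) * q ^ N := by
    intro N p hp
    rw [Finset.HasAntidiagonal.mem_antidiagonal] at hp
    simp only [f, hp]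
  have hf : Summable f := by
    -- Summability is checked along antidiagonals, where the binomial theorem is available.
    rw [← Finset.HasAntidiagonal.sigmaAntidiagonalEquivProd.summable_iff]
    refine Summable.of_norm ?_
    rw [summable_sigma_of_nonneg (fun _ => norm_nonneg _)]
    refine ⟨fun N => Summable.of_finite, ?_⟩
    have hgeo : Summable fun N : ℕ => B ^ 2 * (q / r ^ 2) ^ N :=
      (summable_geometric_of_lt_one (by positivity)
        (by rwa [div_lt_one (by positivity)])).mul_left _
    refine hgeo.of_nonneg_of_le (fun N => tsum_nonneg fun _ => norm_nonneg _) fun N => ?_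
    rw [tsum_fintype]
    have : ∑ p : Finset.HasAntidiagonal.antidiagonal N, ‖f p‖ =
        ∑ p ∈ Finset.HasAntidiagonal.antidiagonal N, ‖f p‖ :=
      Finset.sum_coe_sort (Finset.HasAntidiagonal.antidiagonal N) fun p => ‖f p‖
    refine (this.le.trans (le_of_eq (Finset.sum_congr rfl fun p hp => by
      rw [hanti N p hp, Real.norm_eq_abs, abs_mul, abs_of_nonneg (pow_nonneg hq0 N)]))).trans ?_
    rw [← Finset.sum_mul]
    refine (mul_le_mul_of_nonneg_right (sum_abs_kernelCoeff_term_le hr hr1 hB0 hB hw0 hw1 N)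
      (pow_nonneg hq0 N)).trans (le_of_eq ?_)
    rw [mul_assoc, ← mul_pow]
    congr 2
    ring
  -- Along a row the sum is the binomial series of `(1 - q w) ^ (β - k)`.
  have hinner : ∀ k, HasSum (fun j => f (k, j))
      ((1 - q * w) ^ β * (Ring.choose β k ^ 2 * (q * (1 - w) / (1 - q * w)) ^ k)) := by
    intro k
    have h := (hasSum_choose_mul_pow (β - k) (x := -(q * w))
      (by rw [abs_neg, abs_of_nonneg (mul_nonneg hq0 hw0)]; exact hqw)).mul_left
        (Ring.choose β k ^ 2 * (q * (1 - w)) ^ k)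
    have hterm : (fun j => f (k, j)) = fun j => Ring.choose β k ^ 2 * (q * (1 - w)) ^ k *
        (Ring.choose (β - k) j * (-(q * w)) ^ j) := by
      ext j
      simp only [f]
      have := choose_mul_choose_sub β k j
      rw [mul_pow, neg_pow (q * w), neg_pow w, mul_pow, pow_add]
      linear_combination -(Ring.choose β k * (1 - w) ^ k * (-1) ^ j * w ^ j * q ^ k * q ^ j) * this
    have hsum : (1 - q * w) ^ β * (Ring.choose β k ^ 2 * (q * (1 - w) / (1 - q * w)) ^ k) =
        Ring.choose β k ^ 2 * (q * (1 - w)) ^ k * (1 + -(q * w)) ^ (β - k) := by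
      rw [← sub_eq_add_neg, Real.rpow_sub_natCast hqw0.ne', div_pow]
      ring
    rw [hterm, hsum]
    exact h
  have htot : ∑' p, f p = (1 - q * w) ^ β *
        ordinaryHypergeometric (-β) (-β) (1 : ℝ) (q * (1 - w) / (1 - q * w)) := by
    rw [ordinaryHypergeometric_neg_neg_one, ← tsum_mul_left]
    exact ((hf.hasSum.prod_fiberwise hinner).tsum_eq).symm
  have h := hf.hasSum
  rw [htot, ← Finset.HasAntidiagonal.sigmaAntidiagonalEquivProd.hasSum_iff] at h
  have h' := h.sigma (fun N => hasSum_fintype _)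
  refine h'.congr_fun fun N => ?_
  have : ∑ p : Finset.HasAntidiagonal.antidiagonal N, f p =
      ∑ p ∈ Finset.HasAntidiagonal.antidiagonal N, f p :=
      Finset.sum_coe_sort (Finset.HasAntidiagonal.antidiagonal N) fun p => f p
  rw [kernelCoeff, Finset.mul_sum, Finset.sum_mul]
  exact (Finset.sum_congr rfl fun p hp => (hanti N p hp).symm).trans this.symm

/-! ### Termwise integration -/

theorem choose_succ_mul (β : ℝ) (k : ℕ) :
    Ring.choose β (k + 1) * (k + 1) = Ring.choose β k * (β - k) := by
  have h := choose_mul_choose_sub β k 1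
  rw [Ring.choose_one_right, Nat.choose_succ_self_right] at h
  push_cast at h
  exact h.symm

/-- The Wallis numbers `4 ^ N (N!) ^ 2 / (2N + 1)! = ∫₀¹ (1 - s²) ^ N ds`. -/
noncomputable def wallis (N : ℕ) : ℝ := 4 ^ N * (N ! : ℝ) ^ 2 / (2 * N + 1)!

theorem wallis_zero : wallis 0 = 1 := by simp [wallis]

theorem wallis_succ (N : ℕ) : wallis (N + 1) * (2 * N + 3) = wallis N * (2 * N + 2) := by
  have h : ((2 * N + 1)! : ℝ) ≠ 0 := by positivity
  have h2 : (2 * (N : ℝ) + 3) ≠ 0 := by positivity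
  have h3 : (2 * (N : ℝ) + 2) ≠ 0 := by positivity
  rw [wallis, wallis, show 2 * (N + 1) + 1 = (2 * N + 1) + 1 + 1 by ring, Nat.factorial_succ,
    Nat.factorial_succ, Nat.factorial_succ]
  push_cast
  field_simp
  ring

theorem choose_neg_half_mul_wallis (j : ℕ) :
    Ring.choose (-1 / 2 : ℝ) j * wallis j = (-1) ^ j / (2 * j + 1) := by
  induction j with
  | zero => simp [wallis_zero]
  | succ j ih =>
    have h1 := choose_succ_mul (-1 / 2) j
    have h2 := wallis_succ j
    have h3 : (2 * (j : ℝ) + 1) ≠ 0 := by positivity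
    have h4 : (2 * (j : ℝ) + 3) ≠ 0 := by positivity
    have h5 : ((j : ℝ) + 1) ≠ 0 := by positivity
    rw [eq_div_iff h3] at ih
    rw [eq_div_iff (by positivity)]
    push_cast
    rw [pow_succ]
    apply mul_left_cancel₀ h5
    linear_combination wallis (j + 1) * (2 * j + 3) * h1
      + Ring.choose (-1 / 2 : ℝ) j * (-1 / 2 - j) * h2 - (j + 1) * ih

/-- Integration by parts: `(1 - s²) ^ (k + 1) s ^ (2j + 1)` vanishes at both endpoints. -/
theorem integral_one_sub_sq_pow_succ (k j : ℕ) :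
    (2 * j + 1 : ℝ) * ∫ s in (0 : ℝ)..1, (1 - s ^ 2) ^ (k + 1) * (s ^ 2) ^ j =
      2 * (k + 1) * ∫ s in (0 : ℝ)..1, (1 - s ^ 2) ^ k * (s ^ 2) ^ (j + 1) := by
  have hd : ∀ s : ℝ, HasDerivAt (fun s : ℝ => (1 - s ^ 2) ^ (k + 1) * s ^ (2 * j + 1))
      ((2 * j + 1) * ((1 - s ^ 2) ^ (k + 1) * (s ^ 2) ^ j)
        - 2 * (k + 1) * ((1 - s ^ 2) ^ k * (s ^ 2) ^ (j + 1))) s := by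
    intro s
    have h1 : HasDerivAt (fun s : ℝ => 1 - s ^ 2) (-(2 * s)) s := by
      simpa using (hasDerivAt_pow 2 s).const_sub 1
    have h2 := (h1.pow (k + 1)).mul (hasDerivAt_pow (2 * j + 1) s)
    refine h2.congr_deriv ?_
    simp only [Nat.add_sub_cancel, Pi.pow_apply]
    push_cast
    rw [pow_succ s (2 * j), ← pow_mul, ← pow_mul]
    ring
  have h := intervalIntegral.integral_eq_sub_of_hasDerivAt (a := 0) (b := 1)
    (fun s _ => hd s) (Continuous.intervalIntegrable (by fun_prop) _ _)
  rw [intervalIntegral.integral_sub (Continuous.intervalIntegrable (by fun_prop) _ _)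
    (Continuous.intervalIntegrable (by fun_prop) _ _), intervalIntegral.integral_const_mul,
    intervalIntegral.integral_const_mul] at h
  simp at h
  linarith

/-- The dependence on `(k, j)` splits into a factor depending on `j` only and one depending on
`k + j` only. This turns the integrated coefficients into Vandermonde convolutions. -/
theorem choose_mul_integral_one_sub_sq_pow (k j : ℕ) :
    ((k + j).choose k : ℝ) * (-1) ^ j * ∫ s in (0 : ℝ)..1, (1 - s ^ 2) ^ k * (s ^ 2) ^ j =
      Ring.choose (-1 / 2 : ℝ) j * wallis (k + j) := by
  induction k generalizing j with
  | zero =>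
    simp only [zero_add, choose_neg_half_mul_wallis, ← pow_mul, pow_zero, one_mul, integral_pow]
    simp [div_eq_mul_inv]
  | succ k ih =>
    have h1 := integral_one_sub_sq_pow_succ k j
    have h2 := ih (j + 1)
    have h3 := choose_succ_mul (-1 / 2) j
    have h4 := Nat.choose_succ_right_eq (k + (j + 1)) k
    rw [Nat.add_sub_cancel_left] at h4
    have h4' : (((k + (j + 1)).choose (k + 1) : ℕ) : ℝ) * (k + 1)
      = ((k + (j + 1)).choose k : ℕ) * (j + 1) := by exact_mod_cast h4
    have h5 : (2 * (j : ℝ) + 1) ≠ 0 := by positivity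
    rw [show k + 1 + j = k + (j + 1) by ring]
    rw [pow_succ] at h2
    apply mul_left_cancel₀ h5
    set I := ∫ s in (0 : ℝ)..1, (1 - s ^ 2) ^ (k + 1) * (s ^ 2) ^ j
    set J := ∫ s in (0 : ℝ)..1, (1 - s ^ 2) ^ k * (s ^ 2) ^ (j + 1)
    linear_combination ((k + (j + 1)).choose (k + 1) : ℝ) * (-1) ^ j * h1
      + 2 * (-1) ^ j * J * h4' - 2 * (j + 1) * h2
      - 2 * wallis (k + (j + 1)) * h3

theorem continuous_kernelCoeff (β : ℝ) (N : ℕ) : Continuous (kernelCoeff β N) := by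
  unfold kernelCoeff
  fun_prop

theorem integral_kernelCoeff (β : ℝ) (N : ℕ) :
    ∫ s in (0 : ℝ)..1, kernelCoeff β N (s ^ 2) =
      Ring.choose β N * Ring.choose (β - 1 / 2) N * wallis N := by
  unfold kernelCoeff
  rw [intervalIntegral.integral_const_mul, intervalIntegral.integral_finsetSum
    (fun p _ => Continuous.intervalIntegrable (by fun_prop) _ _), mul_assoc]
  congr 1
  rw [show β - 1 / 2 = β + -1 / 2 by ring, Ring.add_choose_eq N (Commute.all _ _),
    Finset.sum_mul]
  refine Finset.sum_congr rfl fun p hp => ?_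
  rw [Finset.HasAntidiagonal.mem_antidiagonal] at hp
  have h := choose_mul_integral_one_sub_sq_pow p.1 p.2
  rw [hp] at h
  rw [mul_assoc, ← h, ← intervalIntegral.integral_const_mul,
    ← intervalIntegral.integral_const_mul]
  congr 1
  ext s
  rw [neg_pow (s ^ 2)]
  ring

/-- A form of the duplication formula: the factors `2β, 2β - 1, …` of
`Ring.choose (2β + 1) (2N + 1)` after the first one are alternately twice those of
`Ring.choose β N` and twice those of `Ring.choose (β - 1/2) N`. -/
theorem choose_mul_choose_sub_half (β : ℝ) (N : ℕ) :
    (2 * β + 1) * (Ring.choose β N * Ring.choose (β - 1 / 2) N * wallis N) =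
      Ring.choose (2 * β + 1) (2 * N + 1) := by
  induction N with
  | zero => simp [wallis_zero]
  | succ N ih =>
    have h1 := choose_succ_mul β N
    have h2 := choose_succ_mul (β - 1 / 2) N
    have h3 := wallis_succ N
    have h4 := choose_succ_mul (2 * β + 1) (2 * N + 1)
    have h5 := choose_succ_mul (2 * β + 1) (2 * N + 1 + 1)
    push_cast at h4 h5
    have h6 : ((N : ℝ) + 1) ^ 2 * (2 * N + 3) ≠ 0 := by positivity
    rw [show 2 * (N + 1) + 1 = 2 * N + 1 + 1 + 1 by ring]
    apply mul_left_cancel₀ h6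
    set A := Ring.choose β N
    set B := Ring.choose (β - 1 / 2) N
    set A' := Ring.choose β (N + 1)
    set B' := Ring.choose (β - 1 / 2) (N + 1)
    set W := wallis N
    set W' := wallis (N + 1)
    linear_combination (2 * β + 1) * (B' * (N + 1) * W' * (2 * N + 3)) * h1
      + (2 * β + 1) * (A * (β - N)) * W' * (2 * N + 3) * h2
      + (2 * β + 1) * (A * (β - N)) * (B * (β - 1 / 2 - N)) * h3
      + 2 * (N + 1) * (β - N) * (β - 1 / 2 - N) * ih
      - (N + 1) ^ 2 * h5 - (N + 1) * (2 * β - 1 - 2 * N) / 2 * h4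

/-- The odd part of the binomial series. -/
theorem hasSum_choose_odd (a : ℝ) {x : ℝ} (hx : |x| < 1) :
    HasSum (fun N : ℕ => Ring.choose a (2 * N + 1) * x ^ (2 * N + 1))
      (((1 + x) ^ a - (1 - x) ^ a) / 2) := by
  have h1 := hasSum_choose_mul_pow a hx
  have h2 := hasSum_choose_mul_pow a (x := -x) (by rwa [abs_neg])
  have h3 := (h1.sub h2).div_const 2
  rw [← sub_eq_add_neg] at h3
  have hinj : Function.Injective fun N : ℕ => 2 * N + 1 := fun a b h => by simpa using h
  rw [← hinj.hasSum_iff] at h3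
  · refine h3.congr_fun fun N => ?_
    simp only [Function.comp]
    rw [Odd.neg_pow ⟨N, rfl⟩]
    ring
  · intro n hn
    have : Even n := by
      by_contra h
      obtain ⟨m, rfl⟩ := Nat.not_even_iff_odd.1 h
      exact hn ⟨m, rfl⟩
    rw [this.neg_pow]
    ring

theorem integral_rpow_mul_ordinaryHypergeometric (β : ℝ) {x : ℝ} (hx0 : 0 ≤ x) (hx1 : x < 1) :
    (2 * β + 1) * x * ∫ s in (0 : ℝ)..1, (1 - x ^ 2 * s ^ 2) ^ β *
        ordinaryHypergeometric (-β) (-β) (1 : ℝ)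
          (x ^ 2 * (1 - s ^ 2) / (1 - x ^ 2 * s ^ 2)) =
      ((1 + x) ^ (2 * β + 1) - (1 - x) ^ (2 * β + 1)) / 2 := by
  have hq0 : 0 ≤ x ^ 2 := sq_nonneg x
  have hq1 : x ^ 2 < 1 := by nlinarith
  obtain ⟨r, hxr, hr1⟩ := exists_between hx1
  have hr : 0 < r := hx0.trans_lt hxr
  obtain ⟨B, hB0, hB⟩ := exists_abs_choose_mul_pow_le β hr.le hr1
  have hw : ∀ s ∈ uIoc (0 : ℝ) 1, 0 ≤ s ^ 2 ∧ s ^ 2 ≤ 1 := fun s hs => by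
    rw [uIoc_of_le zero_le_one] at hs
    exact ⟨sq_nonneg s, by nlinarith [hs.1, hs.2]⟩
  have hsum : HasSum
      (fun N => ∫ s in (0 : ℝ)..1, kernelCoeff β N (s ^ 2) * (x ^ 2) ^ N)
      (∫ s in (0 : ℝ)..1, (1 - x ^ 2 * s ^ 2) ^ β *
        ordinaryHypergeometric (-β) (-β) (1 : ℝ)
          (x ^ 2 * (1 - s ^ 2) / (1 - x ^ 2 * s ^ 2))) := by
    refine intervalIntegral.hasSum_integral_of_dominated_convergence
      (fun N _ => B ^ 2 * (x ^ 2 / r ^ 2) ^ N) (fun N => ?_) (fun N => ?_) ?_ ?_ ?_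
    · have := continuous_kernelCoeff β N
      exact Continuous.aestronglyMeasurable (by fun_prop)
    · refine .of_forall fun s hs => ?_
      rw [norm_mul, norm_pow, Real.norm_eq_abs, Real.norm_eq_abs, abs_of_nonneg hq0]
      refine (mul_le_mul_of_nonneg_right
        (abs_kernelCoeff_le hr hr1 hB0 hB (hw s hs).1 (hw s hs).2 N)
        (pow_nonneg hq0 N)).trans (le_of_eq ?_)
      rw [mul_assoc, ← mul_pow]
      congr 2
      ring
    · refine .of_forall fun s _ => (summable_geometric_of_lt_one (by positivity) ?_).mul_left _
      rw [div_lt_one (by positivity)]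
      exact pow_lt_pow_left₀ hxr hx0 two_ne_zero
    · exact intervalIntegrable_const
    · exact .of_forall fun s hs =>
        hasSum_kernelCoeff_mul_pow β hq0 hq1 (hw s hs).1 (hw s hs).2
  have h := hsum.mul_left ((2 * β + 1) * x)
  refine h.unique ((hasSum_choose_odd (2 * β + 1)
    (by rwa [abs_of_nonneg hx0])).congr_fun fun N => ?_)
  rw [intervalIntegral.integral_mul_const, integral_kernelCoeff,
    ← choose_mul_choose_sub_half]
  ring

/-! ### Radial weights -/

/-- Normalized by double factorials, the odd powers of `r` form a chain under `(1/r) d/dr`: each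
application lowers `m` by one, without a constant. -/
theorem radialDeriv_iterate_eqOn {g : ℝ → ℝ} {m k : ℕ} (hk : k ≤ m)
    (hg : EqOn g (fun r => r ^ (2 * m + 1) / (2 * m + 1)‼) (Ioi 0)) :
    EqOn (radialDeriv^[k] g)
      (fun r => r ^ (2 * (m - k) + 1) / (2 * (m - k) + 1)‼) (Ioi 0) := by
  induction k generalizing g m with
  | zero => simpa using hg
  | succ k ih =>
    obtain ⟨m, rfl⟩ : ∃ l, m = l + 1 := ⟨m - 1, by omega⟩
    rw [Function.iterate_succ_apply, Nat.add_sub_add_right]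
    refine ih (by omega) fun r hr => ?_
    have hr0 : r ≠ 0 := (mem_Ioi.1 hr).ne'
    have hd : ((2 * m + 1)‼ : ℝ) ≠ 0 := by
      exact_mod_cast (Nat.doubleFactorial_pos _).ne'
    rw [radialDeriv, (hg.eventuallyEq_of_mem (Ioi_mem_nhds hr)).deriv_eq]
    simp only [deriv_div_const, deriv_pow_field]
    rw [show 2 * (m + 1) + 1 = 2 * m + 1 + 2 by ring, Nat.doubleFactorial_add_two]
    rw [show 2 * m + 1 + 2 - 1 = 2 * m + 1 + 1 by omega, pow_succ r (2 * m + 1)]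
    push_cast
    have : (2 * (m : ℝ) + 1 + 2) ≠ 0 := by positivity
    field_simp

theorem differentiableOn_radialDeriv_iterate {g : ℝ → ℝ} {m k : ℕ} (hk : k ≤ m)
    (hg : EqOn g (fun r => r ^ (2 * m + 1) / (2 * m + 1)‼) (Ioi 0)) :
    DifferentiableOn ℝ (radialDeriv^[k] g) (Ioi 0) :=
  DifferentiableOn.congr (by fun_prop) (radialDeriv_iterate_eqOn hk hg)

theorem deriv_radialDeriv_iterate_eq_one {g : ℝ → ℝ} {m : ℕ}
    (hg : EqOn g (fun r => r ^ (2 * m + 1) / (2 * m + 1)‼) (Ioi 0)) {r : ℝ} (hr : 0 < r) :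
    deriv (radialDeriv^[m] g) r = 1 := by
  rw [((radialDeriv_iterate_eqOn le_rfl hg).eventuallyEq_of_mem (Ioi_mem_nhds hr)).deriv_eq]
  simp

theorem sphereArea_pos (k : ℕ) : 0 < sphereArea k := by
  rw [sphereArea, sphereMeasure, Measure.toSphere_real_apply_univ, finrank_euclideanSpace_fin]
  have : 0 < volume.real (ball (0 : EuclideanSpace ℝ (Fin (k + 1))) 1) :=
    ENNReal.toReal_pos (measure_ball_pos _ _ one_pos).ne' measure_ball_lt_top.ne
  positivity

theorem sphericalMean_eq (m : ℕ) (r : ℝ) :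
    sphericalMean (2 * m + 3) r = r ^ (2 * m + 1) / (2 * m + 1)‼ := by
  have h := (sphereArea_pos (2 * m + 2)).ne'
  have hint : ∫ _y : sphere (0 : EuclideanSpace ℝ (Fin (2 * m + 3))) 1, (1 : ℝ)
      ∂(sphereMeasure (2 * m + 3)) = sphereArea (2 * m + 2) := by
    simp [sphereArea]
  rw [sphericalMean, hint]
  simp only [show 2 * m + 3 - 1 = 2 * m + 2 by omega,
    show 2 * m + 3 - 2 = 2 * m + 1 by omega]
  field_simp

theorem one_sub_sq_pos {y : ℝ} (hy : y ∈ Ioo (0 : ℝ) 1) : 0 < 1 - y ^ 2 := by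
  nlinarith [hy.1, hy.2]

theorem hasDerivAt_sqrt_one_sub_sq {y : ℝ} (hy : y ∈ Ioo (0 : ℝ) 1) :
    HasDerivAt (fun y => √(1 - y ^ 2)) (-(y / √(1 - y ^ 2))) y := by
  have h1 : HasDerivAt (fun s : ℝ => 1 - s ^ 2) (-(2 * y)) y := by
    simpa using (hasDerivAt_pow 2 y).const_sub 1
  convert h1.sqrt (one_sub_sq_pos hy).ne' using 1
  ring

theorem intervalIntegrable_pow_div_sqrt_one_sub_sq (m : ℕ) :
    IntervalIntegrable (fun y : ℝ => y ^ (2 * m + 1) / √(1 - y ^ 2)) volume 0 1 := by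
  have h0 : IntervalIntegrable (fun y : ℝ => y / √(1 - y ^ 2)) volume 0 1 := by
    refine intervalIntegral.intervalIntegrable_deriv_of_nonneg (g := fun y => -√(1 - y ^ 2))
      (by fun_prop) (fun y hy => ?_) (fun y hy => ?_)
    · simp only [zero_le_one, inf_of_le_left, sup_of_le_right] at hy
      exact (hasDerivAt_sqrt_one_sub_sq hy).neg.congr_deriv (neg_neg _)
    · simp only [zero_le_one, inf_of_le_left, sup_of_le_right] at hy
      exact div_nonneg hy.1.le (Real.sqrt_nonneg _)
  have h := h0.mul_continuousOn (g := fun y : ℝ => y ^ (2 * m)) (by fun_prop)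
  refine h.congr fun y _ => ?_
  simp only [pow_succ]
  ring

theorem integral_pow_div_sqrt_one_sub_sq (m : ℕ) :
    ∫ y in (0 : ℝ)..1, y ^ (2 * m + 1) / √(1 - y ^ 2) = (2 * m)‼ / (2 * m + 1)‼ := by
  induction m with
  | zero =>
    have h := intervalIntegral.integral_eq_sub_of_hasDerivAt_of_le zero_le_one
      (f := fun y => -√(1 - y ^ 2)) (f' := fun y => y ^ (2 * 0 + 1) / √(1 - y ^ 2)) (by fun_prop)
      (fun y hy => (hasDerivAt_sqrt_one_sub_sq hy).neg.congr_deriv (by simp))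
      (intervalIntegrable_pow_div_sqrt_one_sub_sq 0)
    rw [h]
    simp
  | succ m ih =>
    have h := intervalIntegral.integral_eq_sub_of_hasDerivAt_of_le zero_le_one
      (f := fun y => -(y ^ (2 * m + 2) * √(1 - y ^ 2)))
      (f' := fun y => (2 * m + 3) * (y ^ (2 * (m + 1) + 1) / √(1 - y ^ 2))
        - (2 * m + 2) * (y ^ (2 * m + 1) / √(1 - y ^ 2))) (by fun_prop)
      (fun y hy => by
        have hs := Real.sqrt_pos.2 (one_sub_sq_pos hy)
        have hsq := Real.sq_sqrt (one_sub_sq_pos hy).le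
        refine ((hasDerivAt_pow (2 * m + 2) y).mul
          (hasDerivAt_sqrt_one_sub_sq hy)).neg.congr_deriv ?_
        rw [show 2 * m + 2 - 1 = 2 * m + 1 by omega]
        push_cast
        field_simp
        rw [hsq]
        ring)
      (((intervalIntegrable_pow_div_sqrt_one_sub_sq (m + 1)).const_mul _).sub
        ((intervalIntegrable_pow_div_sqrt_one_sub_sq m).const_mul _))
    rw [intervalIntegral.integral_sub
        ((intervalIntegrable_pow_div_sqrt_one_sub_sq (m + 1)).const_mul _)
        ((intervalIntegrable_pow_div_sqrt_one_sub_sq m).const_mul _),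
      intervalIntegral.integral_const_mul, intervalIntegral.integral_const_mul, ih] at h
    simp at h
    have hd : ((2 * m + 1)‼ : ℝ) ≠ 0 := by
      exact_mod_cast (Nat.doubleFactorial_pos _).ne'
    have h3 : (2 * (m : ℝ) + 3) ≠ 0 := by positivity
    rw [show 2 * (m + 1) + 1 = 2 * m + 1 + 2 by ring, Nat.doubleFactorial_add_two,
      show 2 * (m + 1) = 2 * m + 2 by ring, Nat.doubleFactorial_add_two]
    push_cast
    rw [eq_div_iff (by positivity)]
    rw [show 2 * (m + 1) + 1 = 2 * m + 1 + 2 by ring] at h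
    field_simp at h
    linear_combination h

theorem integrableOn_Ioi_pow_div_sqrt (m : ℕ) :
    IntegrableOn (fun y : ℝ => y ^ (2 * m + 1) • (1 / √(1 - y ^ 2))) (Ioi 0) ∧
    ∫ y in Ioi (0 : ℝ), y ^ (2 * m + 1) • (1 / √(1 - y ^ 2)) = (2 * m)‼ / (2 * m + 1)‼ := by
  have hI := intervalIntegrable_pow_div_sqrt_one_sub_sq m
  rw [intervalIntegrable_iff_integrableOn_Ioc_of_le zero_le_one] at hI
  -- For `y > 1` the square root of the negative number `1 - y²` is `0` in Lean, and so is the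
  -- quotient: the function extends by zero to the half-line.
  have hzero : ∀ y ∈ Ioi (0 : ℝ) \ Ioc 0 1, y ^ (2 * m + 1) / √(1 - y ^ 2) = 0 := by
    intro y hy
    have h1 : 1 < y := by
      by_contra h
      exact hy.2 ⟨hy.1, not_lt.1 h⟩
    rw [Real.sqrt_eq_zero_of_nonpos (by nlinarith), div_zero]
  simp only [smul_eq_mul, mul_one_div]
  refine ⟨hI.of_forall_sdiff_eq_zero measurableSet_Ioi hzero, ?_⟩
  rw [← integral_pow_div_sqrt_one_sub_sq, intervalIntegral.integral_of_le zero_le_one]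
  exact setIntegral_eq_of_subset_of_forall_sdiff_eq_zero measurableSet_Ioi Ioc_subset_Ioi_self hzero

/-- Integrability over the whole space: outside the unit ball the radicand is negative, so the
integrand is `0`. -/
theorem integrable_one_div_sqrt_one_sub_norm_sq (m : ℕ) :
    Integrable (fun y : EuclideanSpace ℝ (Fin (2 * m + 2)) => 1 / √(1 - ‖y‖ ^ 2)) := by
  rw [integrable_fun_norm_addHaar volume (f := fun y => 1 / √(1 - y ^ 2)),
    finrank_euclideanSpace_fin]
  exact (integrableOn_Ioi_pow_div_sqrt m).1

/-- The integral is half the area of the unit sphere one dimension up, since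
`dV / √(1 - |y|²)` is the surface element of the hemisphere over the ball. -/
theorem setIntegral_closedBall_one_div_sqrt (m : ℕ) :
    ∫ y in closedBall (0 : EuclideanSpace ℝ (Fin (2 * m + 2))) 1, 1 / √(1 - ‖y‖ ^ 2)
      = sphereArea (2 * m + 2) / 2 := by
  rw [setIntegral_eq_integral_of_forall_compl_eq_zero, integral_fun_norm_addHaar volume
    (fun y => 1 / √(1 - y ^ 2)), finrank_euclideanSpace_fin,
    show 2 * m + 2 - 1 = 2 * m + 1 by omega, (integrableOn_Ioi_pow_div_sqrt m).2]
  · rw [sphereArea, sphereMeasure, Measure.toSphere_real_apply_univ, finrank_euclideanSpace_fin,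
      Measure.real, Measure.real,
      InnerProductSpace.volume_ball_of_dim_even (k := m + 1) (by simp; ring),
      InnerProductSpace.volume_ball_of_dim_odd (k := m + 1) (by simp; ring),
      finrank_euclideanSpace_fin]
    simp only [ENNReal.ofReal_one, one_pow, one_mul, smul_eq_mul]
    rw [ENNReal.toReal_ofReal (by positivity), ENNReal.toReal_ofReal (by positivity),
      finrank_euclideanSpace_fin, Nat.doubleFactorial_two_mul,
      show 2 * m + 2 + 1 = 2 * m + 1 + 2 by ring, Nat.doubleFactorial_add_two, Nat.factorial_succ]
    have hd : ((2 * m + 1)‼ : ℝ) ≠ 0 := by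
      exact_mod_cast (Nat.doubleFactorial_pos _).ne'
    have hm : ((m : ℝ) + 1) ≠ 0 := by positivity
    rw [nsmul_eq_mul]
    push_cast
    field_simp
    ring
  · intro y hy
    have h1 : 1 < ‖y‖ := by simpa using hy
    rw [Real.sqrt_eq_zero_of_nonpos (by nlinarith), div_zero]

theorem ballMean_eq (m : ℕ) (r : ℝ) :
    ballMean (2 * m + 2) r = r ^ (2 * m + 1) / (2 * m + 1)‼ := by
  have h := (sphereArea_pos (2 * m + 2)).ne'
  rw [ballMean, setIntegral_closedBall_one_div_sqrt, show 2 * m + 2 - 1 = 2 * m + 1 by omega]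
  field_simp

/-! ### The kernel -/

theorem deSitterKernel_neg (M t b z : ℝ) : deSitterKernel M t b (-z) = deSitterKernel M t b z := by
  simp only [deSitterKernel, neg_sq]

theorem continuousOn_deSitterKernel (M t b : ℝ) (hbt : b ≤ t) :
    ContinuousOn (deSitterKernel M t b)
      (Icc (-(Real.exp (-b) - Real.exp (-t))) (Real.exp (-b) - Real.exp (-t))) := by
  have hE : Real.exp (-t) ≤ Real.exp (-b) := Real.exp_le_exp.2 (neg_le_neg hbt)
  have ht := Real.exp_pos (-t)
  set E₁ := Real.exp (-b)
  set E₂ := Real.exp (-t)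
  have hz : ∀ z ∈ Icc (-(E₁ - E₂)) (E₁ - E₂), z ^ 2 ≤ (E₁ - E₂) ^ 2 :=
    fun z hz => sq_le_sq' hz.1 hz.2
  have hpos : ∀ z ∈ Icc (-(E₁ - E₂)) (E₁ - E₂), 0 < (E₁ + E₂) ^ 2 - z ^ 2 := fun z h => by
    nlinarith [hz z h]
  unfold deSitterKernel
  refine (continuousOn_const.mul ?_).mul ?_
  · refine ContinuousOn.rpow_const (by fun_prop) fun z h => Or.inl ?_
    rw [add_comm]
    exact (hpos z h).ne'
  · refine (continuousOn_ordinaryHypergeometric_one _ _).comp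
      (ContinuousOn.div (by fun_prop) (by fun_prop) fun z h => (hpos z h).ne') fun z h => ?_
    rw [mem_ball_zero_iff, Real.norm_eq_abs,
      abs_of_nonneg (div_nonneg (sub_nonneg.2 (hz z h)) (hpos z h).le), div_lt_one (hpos z h)]
    nlinarith

theorem rpow_neg_mul_rpow_two_mul {P A : ℝ} (hP : 0 < P) (hA : 0 ≤ A) (M : ℝ) :
    P ^ (-M) * A ^ (2 * M) = (A ^ 2 / P) ^ M := by
  rw [Real.div_rpow (by positivity) hP.le, Real.rpow_neg hP.le, Real.rpow_mul hA, Real.rpow_two]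
  ring

theorem integral_deSitterKernel_zero (M : ℝ) (hM : 0 < M) (t b : ℝ) (hbt : b ≤ t) :
    ∫ z in (0 : ℝ)..(Real.exp (-b) - Real.exp (-t)), deSitterKernel M t b z =
      Real.sinh (M * (t - b)) / (2 * M) := by
  have hE : Real.exp (-t) ≤ Real.exp (-b) := Real.exp_le_exp.2 (neg_le_neg hbt)
  have ht := Real.exp_pos (-t)
  have hb := Real.exp_pos (-b)
  have hP : 0 < 4 * Real.exp (-b - t) := by positivity
  have hplus :
      Real.exp (M * (t - b)) = ((2 * Real.exp (-b)) ^ 2 / (4 * Real.exp (-b - t))) ^ M := by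
    rw [mul_comm M, Real.exp_mul]
    congr 1
    rw [eq_div_iff hP.ne', mul_pow, ← Real.exp_nat_mul, mul_left_comm, ← Real.exp_add]
    push_cast
    ring_nf
  have hminus :
      Real.exp (-(M * (t - b))) = ((2 * Real.exp (-t)) ^ 2 / (4 * Real.exp (-b - t))) ^ M := by
    rw [neg_mul_eq_mul_neg, mul_comm M, Real.exp_mul]
    congr 1
    rw [eq_div_iff hP.ne', mul_pow, ← Real.exp_nat_mul, mul_left_comm, ← Real.exp_add]
    push_cast
    ring_nf
  rw [Real.sinh_eq, hplus, hminus, ← rpow_neg_mul_rpow_two_mul hP (by positivity),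
    ← rpow_neg_mul_rpow_two_mul hP (by positivity)]
  set P := 4 * Real.exp (-b - t)
  set E₁ := Real.exp (-b) with hE₁
  set E₂ := Real.exp (-t) with hE₂
  set S := E₁ + E₂ with hS
  set x := (E₁ - E₂) / S with hx
  have hSpos : 0 < S := by positivity
  have hx0 : 0 ≤ x := div_nonneg (sub_nonneg.2 hE) hSpos.le
  have hx1 : x < 1 := by rw [hx, div_lt_one hSpos]; linarith
  have hR : E₁ - E₂ = S * x := by rw [hx]; field_simp
  have hplus' : 2 * E₁ = S * (1 + x) := by rw [mul_add, ← hR, hS]; ring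
  have hminus' : 2 * E₂ = S * (1 - x) := by rw [mul_sub, ← hR, hS]; ring
  have hβ : 1 / 2 - M = -(-(1 / 2 : ℝ) + M) := by ring
  have hscale : ∫ s in (0 : ℝ)..1, deSitterKernel M t b (S * x * s) =
      P ^ (-M) * (S ^ 2) ^ (-(1 / 2 : ℝ) + M) *
        ∫ s in (0 : ℝ)..1, (1 - x ^ 2 * s ^ 2) ^ (-(1 / 2 : ℝ) + M) *
          ordinaryHypergeometric (-(-(1 / 2 : ℝ) + M)) (-(-(1 / 2 : ℝ) + M)) (1 : ℝ)
            (x ^ 2 * (1 - s ^ 2) / (1 - x ^ 2 * s ^ 2)) := by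
    rw [← intervalIntegral.integral_const_mul]
    refine intervalIntegral.integral_congr fun s hs => ?_
    rw [uIcc_of_le zero_le_one] at hs
    have hs2 : s ^ 2 ≤ 1 := by nlinarith [hs.1, hs.2]
    have hpos : 0 < 1 - x ^ 2 * s ^ 2 := by nlinarith [sq_nonneg s, sq_nonneg x]
    have hden : S ^ 2 - (S * x * s) ^ 2 = S ^ 2 * (1 - x ^ 2 * s ^ 2) := by ring
    have hnum : (S * x) ^ 2 - (S * x * s) ^ 2 = S ^ 2 * (x ^ 2 * (1 - s ^ 2)) := by ring
    simp only [deSitterKernel]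
    rw [← hE₁, ← hE₂, add_comm E₂ E₁, ← hS, hR, hden, hnum, hβ,
      mul_div_mul_left _ _ (by positivity), Real.mul_rpow (by positivity) hpos.le]
    ring
  have hI := integral_rpow_mul_ordinaryHypergeometric (-(1 / 2 : ℝ) + M) hx0 hx1
  have hS2 : (S ^ 2) ^ (-(1 / 2 : ℝ) + M) * S = S ^ (2 * M) := by
    rw [← Real.rpow_natCast S 2, ← Real.rpow_mul hSpos.le, ← Real.rpow_add_one hSpos.ne']
    congr 1
    push_cast
    ring
  have hsub := intervalIntegral.mul_integral_comp_mul_left (a := 0) (b := 1)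
    (f := deSitterKernel M t b) (c := S * x)
  rw [mul_zero, mul_one] at hsub
  rw [hR, ← hsub, hscale, hplus', hminus', Real.mul_rpow hSpos.le (by linarith),
    Real.mul_rpow hSpos.le (by linarith), ← hS2]
  rw [show 2 * (-(1 / 2 : ℝ) + M) + 1 = 2 * M by ring] at hI
  rw [eq_div_iff (by positivity)]
  linear_combination P ^ (-M) * ((S ^ 2) ^ (-(1 / 2 : ℝ) + M) * S) * hI

theorem intervalIntegrable_deSitterKernel (M t b : ℝ) (hbt : b ≤ t) :
    IntervalIntegrable (deSitterKernel M t b) volume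
        (-(Real.exp (-b) - Real.exp (-t))) (Real.exp (-b) - Real.exp (-t)) := by
  have hE : Real.exp (-t) ≤ Real.exp (-b) := Real.exp_le_exp.2 (neg_le_neg hbt)
  exact (continuousOn_deSitterKernel M t b hbt).intervalIntegrable_of_Icc (by linarith)

/-- A weight equal to `1` for `r > 0` may be inserted in the integral over half the interval. -/
theorem integral_deSitterKernel_weight (M : ℝ) (hM : 0 < M) (t b : ℝ) (hbt : b ≤ t) {w : ℝ → ℝ}
    (hw : ∀ r, 0 < r → w r = 1) :
    IntervalIntegrable (fun r => w r * deSitterKernel M t b r) volume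
        0 (Real.exp (-b) - Real.exp (-t)) ∧
      1 / M * Real.sinh (M * (t - b)) =
        2 * ∫ r in (0 : ℝ)..(Real.exp (-b) - Real.exp (-t)), w r * deSitterKernel M t b r := by
  have hE : Real.exp (-t) ≤ Real.exp (-b) := Real.exp_le_exp.2 (neg_le_neg hbt)
  have heq : EqOn (deSitterKernel M t b) (fun r => w r * deSitterKernel M t b r)
      (uIoc 0 (Real.exp (-b) - Real.exp (-t))) := fun r hr => by
    rw [uIoc_of_le (by linarith)] at hr
    simp only [hw r hr.1, one_mul]
  constructor
  · refine IntervalIntegrable.congr heq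
      ((intervalIntegrable_deSitterKernel M t b hbt).mono_set ?_)
    rw [uIcc_of_le (by linarith), uIcc_of_le (by linarith)]
    exact Icc_subset_Icc_left (by linarith)
  · rw [← intervalIntegral.integral_congr_ae (.of_forall heq),
      integral_deSitterKernel_zero M hM t b hbt]
    field_simp

theorem integral_deSitterKernel (M : ℝ) (hM : 0 < M) (t b : ℝ) (hbt : b ≤ t) :
    1 / M * Real.sinh (M * (t - b)) =
      ∫ z in (-(Real.exp (-b) - Real.exp (-t)))..(Real.exp (-b) - Real.exp (-t)),
        deSitterKernel M t b z := by
  have hE : Real.exp (-t) ≤ Real.exp (-b) := Real.exp_le_exp.2 (neg_le_neg hbt)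
  have hint := intervalIntegrable_deSitterKernel M t b hbt
  have hneg := intervalIntegral.integral_comp_neg (a := 0) (b := Real.exp (-b) - Real.exp (-t))
    (deSitterKernel M t b)
  simp only [deSitterKernel_neg, neg_zero] at hneg
  rw [← intervalIntegral.integral_add_adjacent_intervals (b := 0)
    (hint.mono_set ?_) (hint.mono_set ?_), ← hneg, integral_deSitterKernel_zero M hM t b hbt]
  · field_simp
    ring
  all_goals
    rw [uIcc_of_le (by linarith), uIcc_of_le (by linarith)]
    exact Icc_subset_Icc (by linarith) (by linarith)

theorem proposition2p1 (M : ℝ) (hM : 0 < M) (t b : ℝ) (hb : 0 ≤ b) (hbt : b ≤ t) :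
    -- (i) the one-dimensional integral
    (IntervalIntegrable (deSitterKernel M t b) volume
        (-(Real.exp (-b) - Real.exp (-t))) (Real.exp (-b) - Real.exp (-t)) ∧
      1 / M * Real.sinh (M * (t - b)) =
        ∫ z in (-(Real.exp (-b) - Real.exp (-t)))..(Real.exp (-b) - Real.exp (-t)),
          deSitterKernel M t b z) ∧
    -- (ii) odd `n ≥ 3`
    (∀ n : ℕ, Odd n → 3 ≤ n →
      (∀ k ≤ (n - 3) / 2, DifferentiableOn ℝ (radialDeriv^[k] (sphericalMean n)) (Ioi 0)) ∧
      IntervalIntegrable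
        (fun r₁ => deriv (radialDeriv^[(n - 3) / 2] (sphericalMean n)) r₁
          * deSitterKernel M t b r₁) volume 0 (Real.exp (-b) - Real.exp (-t)) ∧
      1 / M * Real.sinh (M * (t - b)) =
        2 * ∫ r₁ in (0 : ℝ)..(Real.exp (-b) - Real.exp (-t)),
          deriv (radialDeriv^[(n - 3) / 2] (sphericalMean n)) r₁ * deSitterKernel M t b r₁) ∧
    -- (iii) even `n ≥ 2`
    (∀ n : ℕ, Even n → 2 ≤ n →
      IntegrableOn (fun y : EuclideanSpace ℝ (Fin n) => 1 / √(1 - ‖y‖ ^ 2))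
        (closedBall 0 1) volume ∧
      (∀ k ≤ (n - 2) / 2, DifferentiableOn ℝ (radialDeriv^[k] (ballMean n)) (Ioi 0)) ∧
      IntervalIntegrable
        (fun r₁ => deriv (radialDeriv^[(n - 2) / 2] (ballMean n)) r₁
          * deSitterKernel M t b r₁) volume 0 (Real.exp (-b) - Real.exp (-t)) ∧
      1 / M * Real.sinh (M * (t - b)) =
        2 * ∫ r₁ in (0 : ℝ)..(Real.exp (-b) - Real.exp (-t)),
          deriv (radialDeriv^[(n - 2) / 2] (ballMean n)) r₁ * deSitterKernel M t b r₁) := by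
  refine ⟨⟨intervalIntegrable_deSitterKernel M t b hbt, integral_deSitterKernel M hM t b hbt⟩,
    fun n hn h3 => ?_, fun n hn h2 => ?_⟩
  · obtain ⟨m, rfl⟩ : ∃ m, n = 2 * m + 3 := by
      obtain ⟨l, rfl⟩ := hn
      exact ⟨l - 1, by omega⟩
    have hg : EqOn (sphericalMean (2 * m + 3)) (fun r => r ^ (2 * m + 1) / (2 * m + 1)‼) (Ioi 0) :=
      fun r _ => sphericalMean_eq m r
    rw [show (2 * m + 3 - 3) / 2 = m by omega]
    exact ⟨fun k hk => differentiableOn_radialDeriv_iterate hk hg,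
      integral_deSitterKernel_weight M hM t b hbt fun r => deriv_radialDeriv_iterate_eq_one hg⟩
  · obtain ⟨m, rfl⟩ : ∃ m, n = 2 * m + 2 := by
      obtain ⟨l, rfl⟩ := hn
      exact ⟨l - 1, by omega⟩
    have hg : EqOn (ballMean (2 * m + 2)) (fun r => r ^ (2 * m + 1) / (2 * m + 1)‼) (Ioi 0) :=
      fun r _ => ballMean_eq m r
    rw [show (2 * m + 2 - 2) / 2 = m by omega]
    exact ⟨(integrable_one_div_sqrt_one_sub_norm_sq m).integrableOn,
      fun k hk => differentiableOn_radialDeriv_iterate hk hg,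
      integral_deSitterKernel_weight M hM t b hbt fun r => deriv_radialDeriv_iterate_eq_one hg⟩
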